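/- Let $G$ be an infinite compact (Hausdorff) abelian group with normalized Haar measure $m$ (the regular, translation-invariant Borel probability measure), and let $\Gamma$ be its dual group, i.e. the group of all continuous homomorphisms from $G$ into the circle group. For $f \in L^1(G) = L^1(G,m;\mathbb{C})$ and for a regular complex Borel measure $\mu$ on $G$ put $\hat f(\gamma) = \int_G f\,\overline{\gamma}\,dm$ and $\hat\mu(\gamma) = \int_G \overline{\gamma}\,d\mu$ ($\gamma \in \Gamma$). For $\Theta \subset \Gamma$ let $$L^1_\Theta(G) = \{ f \in L^1(G) : \hat f(\gamma) = 0 \text{ for all } \gamma \in \Gamma\setminus\Theta \},$$ a closed subspace of $L^1(G)$, and let $M_\Theta(G)$ be the set of all regular complex Borel measures $\mu$ on $G$ with $\hat\mu(\gamma) = 0$ for all $\gamma\in\Gamma\setminus\Theta$. A bounded linear operator $T : X \to E$ between Banach spaces is called narrow if for all $x, y \in X$ with $\|x\| = \|y\| = 1$, every $x^* \in X^*$ and every $\varepsilon > 0$ there is $z \in X$ with $\|z\| = 1$, $\|T(y-z)\| + |x^*(y-z)| \le \varepsilon$ and $\|x+z\| \ge 2 - \varepsilon$. A closed subspace $Y$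 of $X$ is called rich if the quotient map $X \to X/Y$ is narrow. A set $\Lambda \subset \Gamma$ is called a semi-Riesz set if every $\mu \in M_\Lambda(G)$ is diffuse, i.e. satisfies $\mu(B) = 0$ for all countable $B \subset G$. Theorem. Let $\Lambda \subset \Gamma$ and $\Lambda^{-1} = \{\gamma^{-1} : \gamma \in \Lambda\}$. If $L^1_{\Gamma\setminus\Lambda^{-1}}(G)$ is a rich subspace of $L^1(G)$, then $\Lambda$ is a semi-Riesz set. -/

import Mathlib

open MeasureTheory
open scoped Pointwise ComplexConjugate

noncomputable section

/-! ### Narrow operators and rich subspaces -/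

/-- A bounded operator `T : X → E` is *narrow* if for all `x, y` in the unit sphere of `X`, every
functional `φ` on `X` and every `ε > 0` there is `z` in the unit sphere of `X` such that
`‖T (y - z)‖ + |φ (y - z)| ≤ ε` and `‖x + z‖ ≥ 2 - ε`. (The notion is used for spaces `X` with the
Daugavet property; that property follows from the existence of a narrow operator on `X`.) -/
def IsNarrow {𝕜 X E : Type*} [RCLike 𝕜] [NormedAddCommGroup X] [NormedSpace 𝕜 X]
    [NormedAddCommGroup E] [NormedSpace 𝕜 E] (T : X →L[𝕜] E) : Prop :=
  ∀ x y : X, ‖x‖ = 1 → ‖y‖ = 1 → ∀ φ : X →L[𝕜] 𝕜, ∀ ε : ℝ, 0 < ε →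
    ∃ z : X, ‖z‖ = 1 ∧ ‖T (y - z)‖ + ‖φ (y - z)‖ ≤ ε ∧ 2 - ε ≤ ‖x + z‖

/-- A closed subspace `Y` of `X` is *rich* if the quotient map `X → X ⧸ Y` is narrow. -/
def IsRich {𝕜 X : Type*} [RCLike 𝕜] [NormedAddCommGroup X] [NormedSpace 𝕜 X]
    (Y : ClosedSubmodule 𝕜 X) : Prop :=
  haveI : IsClosed (Y.toSubmodule : Set X) := Y.isClosed
  IsNarrow (𝕜 := 𝕜) Y.toSubmodule.mkQL

/-! ### Spectra of integrable functions and of measures -/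

variable {G : Type*} [CommGroup G] [TopologicalSpace G] [MeasurableSpace G]

/-- The Fourier transform `∫ conj γ * f dm` of `f ∈ L¹(G)` at the character `γ`. -/
def fourierL1 {m : Measure G} (f : Lp ℂ 1 m) (γ : PontryaginDual G) : ℂ :=
  ∫ x, conj (γ x : ℂ) * f x ∂m

/-- The spectrum of `f ∈ L¹(G)`: the characters at which its Fourier transform is not zero. -/
def specL1 {m : Measure G} (f : Lp ℂ 1 m) : Set (PontryaginDual G) :=
  {γ | fourierL1 f γ ≠ 0}

theorem integrable_conj_char_mul [BorelSpace G] {m : Measure G} (f : Lp ℂ 1 m)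
    (γ : PontryaginDual G) : Integrable (fun x => conj (γ x : ℂ) * f x) m := by
  refine (L1.integrable_coeFn f).bdd_mul (c := 1) ?_ ?_
  · have : Continuous fun x => conj (γ x : ℂ) := by
      have := map_continuous γ
      fun_prop
    exact this.measurable.aestronglyMeasurable
  · exact Filter.Eventually.of_forall fun x => by
      rw [RCLike.norm_conj, Circle.norm_coe (γ x)]

theorem fourierL1_add [BorelSpace G] {m : Measure G} (f g : Lp ℂ 1 m) (γ : PontryaginDual G) :
    fourierL1 (f + g) γ = fourierL1 f γ + fourierL1 g γ := by
  unfold fourierL1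
  rw [← integral_add (integrable_conj_char_mul f γ) (integrable_conj_char_mul g γ)]
  refine integral_congr_ae ?_
  filter_upwards [Lp.coeFn_add f g] with x hx
  rw [hx, Pi.add_apply, mul_add]

theorem fourierL1_smul [BorelSpace G] {m : Measure G} (c : ℂ) (f : Lp ℂ 1 m)
    (γ : PontryaginDual G) : fourierL1 (c • f) γ = c * fourierL1 f γ := by
  unfold fourierL1
  rw [← integral_const_mul]
  refine integral_congr_ae ?_
  filter_upwards [Lp.coeFn_smul c f] with x hx
  rw [hx, Pi.smul_apply, smul_eq_mul, mul_left_comm]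

/-- The Fourier transform at `γ` as a bounded linear functional on `L¹(G)`. -/
def fourierL1CLM [BorelSpace G] (m : Measure G) (γ : PontryaginDual G) : Lp ℂ 1 m →L[ℂ] ℂ :=
  LinearMap.mkContinuous
    { toFun := fun f => fourierL1 f γ
      map_add' := fun f g => fourierL1_add f g γ
      map_smul' := fun c f => fourierL1_smul c f γ } 1 (fun f => by
        change ‖∫ x, conj (γ x : ℂ) * f x ∂m‖ ≤ 1 * ‖f‖
        rw [one_mul, L1.norm_eq_integral_norm]
        refine (norm_integral_le_integral_norm _).trans_eq ?_
        refine integral_congr_ae (Filter.Eventually.of_forall fun x => ?_)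
        change ‖conj (γ x : ℂ) * f x‖ = ‖f x‖
        rw [norm_mul, RCLike.norm_conj, Circle.norm_coe (γ x), one_mul])

/-- `L¹_Λ(G)`, the closed subspace of all `f ∈ L¹(G)` with spectrum contained in `Λ`. -/
def L1Spec [BorelSpace G] (m : Measure G) (Λ : Set (PontryaginDual G)) :
    ClosedSubmodule ℂ (Lp ℂ 1 m) where
  carrier := {f | specL1 f ⊆ Λ}
  zero_mem' := fun γ hγ => absurd (map_zero (fourierL1CLM m γ)) hγ
  add_mem' := fun {f g} hf hg γ hγ => by
    by_contra h
    have h1 : fourierL1 f γ = 0 := by_contra fun h' => h (hf h')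
    have h2 : fourierL1 g γ = 0 := by_contra fun h' => h (hg h')
    exact hγ (by rw [fourierL1_add, h1, h2, add_zero])
  smul_mem' := fun c f hf γ hγ => by
    by_contra h
    have h1 : fourierL1 f γ = 0 := by_contra fun h' => h (hf h')
    exact hγ (by rw [fourierL1_smul, h1, mul_zero])
  isClosed' := by
    have : {f : Lp ℂ 1 m | specL1 f ⊆ Λ} = ⋂ γ ∈ Λᶜ, {f | fourierL1CLM m γ f = 0} := by
      ext f
      simp only [Set.mem_ofPred_eq, Set.mem_iInter]
      exact ⟨fun h γ hγ => by_contra fun h' => hγ (h h'),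
        fun h γ hγ => by_contra fun h' => hγ (h γ h')⟩
    change IsClosed {f : Lp ℂ 1 m | specL1 f ⊆ Λ}
    rw [this]
    exact isClosed_biInter fun γ _ =>
      isClosed_eq (fourierL1CLM m γ).continuous continuous_const

/-- The Fourier-Stieltjes transform `∫ conj γ dμ` of a complex measure `μ` at the
character `γ`. -/
def fourierStieltjes (μ : ComplexMeasure G) (γ : PontryaginDual G) : ℂ :=
  VectorMeasure.integral μ (fun x => conj (γ x : ℂ)) (ContinuousLinearMap.mul ℝ ℂ)

/-- The spectrum of a complex measure: the characters at which its Fourier-Stieltjes transform is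
not zero. -/
def specMeasure (μ : ComplexMeasure G) : Set (PontryaginDual G) :=
  {γ | fourierStieltjes μ γ ≠ 0}

/-- `M_Λ(G)`, the set of all regular complex Borel measures (complex measures with regular total
variation) with spectrum contained in `Λ`. -/
def measuresWithSpec (Λ : Set (PontryaginDual G)) : Set (ComplexMeasure G) :=
  {μ | μ.variation.Regular ∧ specMeasure μ ⊆ Λ}

/-- A complex measure is *diffuse* if all countable sets have measure zero. -/
def IsDiffuse (μ : ComplexMeasure G) : Prop :=
  ∀ B : Set G, B.Countable → μ B = 0

/-- `Λ` is a *semi-Riesz set* if every measure in `M_Λ(G)` is diffuse. -/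
def IsSemiRiesz (Λ : Set (PontryaginDual G)) : Prop :=
  ∀ μ ∈ measuresWithSpec Λ, IsDiffuse μ

end

/-! ### Characters separate the points of a compact abelian group -/

/-! Let `Y` be the rich subspace and `μ ∈ M_Λ`. Convolution with `μ` multiplies each character `γ`
by `μ̂(γ)`, and `∫ γ f dm = f̂(γ⁻¹)` vanishes for `f ∈ Y` and `γ ∈ Λ`. Since trigonometric
polynomials are dense in `C(G)`, every `f ∈ Y` annihilates every `μ * h` with `h` continuous
(`pairL1_convMeasure_eq_zero`). Richness yields `w` of norm almost 2, almost in `Y` and almost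
carried by a small neighbourhood `K` of 1 (`IsRich.exists_concentrated`). Suppose `μ` has an atom at
`b`. Choose `κ` supported near 1 that nearly norms `w`, and translate it to live near `b⁻¹`. On `K`
its convolution with `μ` is close to `μ {b} • κ`, because regularity leaves little other mass of `μ`
near `b` (`norm_convMeasure_sub_le`). Its pairing with `w` is then both nearly 0 and of size about
`2 ‖μ {b}‖`, a contradiction. The density of trigonometric polynomials rests on Stone–Weierstrass
and on characters separating points, which is derived from Gelfand theory applied to translations of
`L²(G)`. -/

/-- `T` and the unitaries `u x` generate a commutative C⋆-algebra, and a Gelfand character `χ` of it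
restricts to a homomorphism `χ ∘ u` into the circle. As `u` need not be norm continuous, `T` serves
as a smoothing factor: continuity of `χ (T * u x)` gives that of `χ (u x)` once `χ T ≠ 0`. -/
theorem exists_pontryaginDual_ne_one_of_cstar {G A : Type*} [CommGroup G] [TopologicalSpace G]
    [CStarAlgebra A] (u : G →* A) (hu : ∀ x, star (u x) = u x⁻¹) (T : A) (hT : IsSelfAdjoint T)
    (hcomm : ∀ x, u x * T = T * u x) (hcont : Continuous fun x => T * u x) {x₀ : G}
    (hx₀ : T * u x₀ ≠ T) : ∃ γ : PontryaginDual G, γ x₀ ≠ 1 := by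
  have hs : ∀ a ∈ insert T (Set.range u), ∀ b ∈ insert T (Set.range u), a * b = b * a := by
    rintro a (rfl | ⟨x, rfl⟩) b (rfl | ⟨y, rfl⟩)
    · rfl
    · exact (hcomm y).symm
    · exact hcomm x
    · rw [← map_mul, ← map_mul, mul_comm]
  have hs' : ∀ a ∈ insert T (Set.range u), star a ∈ insert T (Set.range u) := by
    rintro a (rfl | ⟨x, rfl⟩)
    · exact .inl hT
    · exact .inr ⟨x⁻¹, (hu x).symm⟩
  set S : StarSubalgebra ℂ A := StarAlgebra.adjoin ℂ (insert T (Set.range u)) with hS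
  have hSc : IsMulCommutative S :=
    StarAlgebra.isMulCommutative_adjoin ℂ hs fun a ha b hb => hs a ha _ (hs' b hb)
  let : CommCStarAlgebra S.topologicalClosure :=
    { StarSubalgebra.cstarAlgebra S.topologicalClosure
        (h_closed := S.isClosed_topologicalClosure),
      S.commRingTopologicalClosure fun x y => hSc.is_comm.comm x y with }
  have hmem : ∀ a ∈ insert T (Set.range u), a ∈ S.topologicalClosure := fun a ha =>
    S.le_topologicalClosure (StarAlgebra.subset_adjoin ℂ _ ha)
  let t : S.topologicalClosure := ⟨T, hmem T (.inl rfl)⟩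
  let v : G →* S.topologicalClosure :=
    { toFun := fun x => ⟨u x, hmem _ (.inr ⟨x, rfl⟩)⟩
      map_one' := Subtype.ext (map_one u)
      map_mul' := fun x y => Subtype.ext (map_mul u x y) }
  have hne : t * v x₀ - t ≠ 0 := fun h => hx₀ (congrArg Subtype.val (sub_eq_zero.1 h))
  -- The Gelfand transform is injective. Since `χ (t * v x₀ - t) = χ t * (χ (v x₀) - 1)`, this one
  -- `χ` gives both `χ t ≠ 0` and `χ (v x₀) ≠ 1`.
  obtain ⟨χ, hχ⟩ : ∃ χ : WeakDual.characterSpace ℂ S.topologicalClosure,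
      χ (t * v x₀ - t) ≠ 0 := by
    by_contra! h
    refine hne ((gelfandTransform_isometry S.topologicalClosure).injective ?_)
    ext χ
    simpa using h χ
  rw [map_sub, map_mul] at hχ
  have ht : χ t ≠ 0 := fun h => hχ (by rw [h, zero_mul, sub_zero])
  have hnorm : ∀ x, χ (v x) ∈ Submonoid.unitSphere ℂ := fun x => by
    have h1 : star (v x) * v x = 1 := by
      have : star (v x) = v x⁻¹ := Subtype.ext (hu x)
      rw [this, ← map_mul, inv_mul_cancel, map_one]
    have h2 : conj (χ (v x)) * χ (v x) = 1 := by
      rw [← map_one χ, ← h1, map_mul, map_star]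
      rfl
    rw [Complex.conj_mul'] at h2
    rw [Submonoid.unitSphere, Submonoid.mem_mk, Subsemigroup.mem_mk, mem_sphere_zero_iff_norm]
    have h3 : ‖χ (v x)‖ ^ 2 = 1 := by exact_mod_cast h2
    exact (pow_eq_one_iff_of_nonneg (norm_nonneg _) two_ne_zero).1 h3
  have hv : Continuous fun x => χ (v x) := by
    have h1 : Continuous fun x => χ (t * v x) :=
      (map_continuous χ).comp (hcont.subtype_mk _)
    refine (h1.div_const (χ t)).congr fun x => ?_
    rw [map_mul, mul_div_cancel_left₀ _ ht]
  let γ : G →ₜ* Circle :=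
    { toFun := fun x => ⟨χ (v x), hnorm x⟩
      map_one' := Circle.ext (by simp)
      map_mul' := fun x y => Circle.ext (by
        change χ (v (x * y)) = χ (v x) * χ (v y)
        rw [map_mul, map_mul])
      continuous_toFun := hv.subtype_mk _ }
  refine ⟨γ, fun h => hχ ?_⟩
  have : χ (v x₀) = 1 := congrArg ((↑) : Circle → ℂ) h
  rw [this, mul_one, sub_self]

/-- The matrix coefficient map `g ↦ (x ↦ ⟪u x k, g⟫)` of a strongly continuous isometric
representation. -/
noncomputable def matrixCoeff {G H : Type*} [CommGroup G] [TopologicalSpace G] [CompactSpace G]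
    [NormedAddCommGroup H] [InnerProductSpace ℂ H] (u : G →* (H →L[ℂ] H))
    (hu : ∀ x v, ‖u x v‖ = ‖v‖) (hc : ∀ v, Continuous fun x => u x v) (k : H) :
    H →L[ℂ] C(G, ℂ) :=
  LinearMap.mkContinuous
    { toFun := fun g => ⟨fun x => inner ℂ (u x k) g, (hc k).inner continuous_const⟩
      map_add' := fun g g' => by ext x; simp
      map_smul' := fun c g => by ext x; simp } ‖k‖ fun g => by
    refine (ContinuousMap.norm_le _ (by positivity)).2 fun x => ?_
    simpa [hu] using norm_inner_le_norm (𝕜 := ℂ) (u x k) g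

/-! ### Translations of `L²(G)` and their smoothing by matrix coefficients -/

section Haar

variable {G : Type*} [CommGroup G] [TopologicalSpace G] [IsTopologicalGroup G]
  [MeasurableSpace G] [BorelSpace G]

/-- The translation representation on `L²(G)`. -/
noncomputable def translationL2 (m : Measure G) [m.IsMulLeftInvariant] :
    G →* (Lp ℂ 2 m →L[ℂ] Lp ℂ 2 m) where
  toFun x := (Lp.compMeasurePreservingₗᵢ ℂ (x • ·) (measurePreserving_smul x m)).toContinuousLinearMap
  map_one' := by
    ext1 f
    exact one_smul Gᵈᵐᵃ f
  map_mul' x y := by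
    ext1 f
    rw [mul_comm x y]
    exact mul_smul (DomMulAct.mk x) (DomMulAct.mk y) f

variable (m : Measure G) [m.IsHaarMeasure]

theorem norm_translationL2 (x : G) (f : Lp ℂ 2 m) : ‖translationL2 m x f‖ = ‖f‖ :=
  LinearIsometry.norm_map _ f

theorem translationL2_ae (x : G) (f : Lp ℂ 2 m) :
    translationL2 m x f =ᵐ[m] fun y => f (x * y) :=
  Lp.coeFn_compMeasurePreserving _ _

variable [m.Regular] [CompactSpace G]

set_option linter.overlappingInstances false
set_option linter.unusedSectionVars false

theorem continuous_translationL2 (f : Lp ℂ 2 m) : Continuous fun x => translationL2 m x f := by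
  have : Fact ((2 : ENNReal) ≠ ⊤) := ⟨by simp⟩
  have h : Continuous fun x : G => DomMulAct.mk x • f :=
    (DomMulAct.continuous_mk (M := G)).smul continuous_const
  exact h

theorem star_translationL2 (x : G) : star (translationL2 m x) = translationL2 m x⁻¹ := by
  have h : star (translationL2 m x) * translationL2 m x = 1 := by
    rw [ContinuousLinearMap.star_eq_adjoint]
    exact (ContinuousLinearMap.norm_map_iff_adjoint_comp_self _).1 (norm_translationL2 m x)
  calc star (translationL2 m x)
      = star (translationL2 m x) * (translationL2 m x * translationL2 m x⁻¹) := by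
        rw [← map_mul, mul_inv_cancel, map_one, mul_one]
    _ = translationL2 m x⁻¹ := by rw [← mul_assoc, h, one_mul]

theorem inner_translationL2 (x : G) (f g : Lp ℂ 2 m) :
    inner ℂ (translationL2 m x f) g = inner ℂ f (translationL2 m x⁻¹ g) := by
  rw [← star_translationL2, ContinuousLinearMap.star_eq_adjoint,
    ContinuousLinearMap.adjoint_inner_right]

/-- The matrix coefficient map of the translation representation as an operator on `L²(G)`. -/
noncomputable def coeffL2 (k : Lp ℂ 2 m) : Lp ℂ 2 m →L[ℂ] Lp ℂ 2 m :=
  (ContinuousMap.toLp 2 m ℂ).comp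
    (matrixCoeff (translationL2 m) (norm_translationL2 m) (continuous_translationL2 m) k)

/-- The inverse appears because the operator is a correlation, `g ↦ ∫ conj k(xy) g(y) dy`. It
cancels in `star S * S`, which therefore commutes with translations. -/
theorem coeffL2_mul_translationL2 (k : Lp ℂ 2 m) (a : G) :
    coeffL2 m k * translationL2 m a = translationL2 m a⁻¹ * coeffL2 m k := by
  ext1 g
  apply Lp.ext
  refine (ContinuousMap.coeFn_toLp m _).trans ?_
  refine .trans ?_ (translationL2_ae m a⁻¹ _).symm
  have h := (measurePreserving_mul_left m a⁻¹).quasiMeasurePreserving.ae_eq_comp (ContinuousMap.coeFn_toLp (p := 2) (𝕜 := ℂ) m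
    (matrixCoeff (translationL2 m) (norm_translationL2 m) (continuous_translationL2 m) k g))
  refine .trans (.of_forall fun x => ?_) h.symm
  change inner ℂ (translationL2 m x k) (translationL2 m a g) =
    inner ℂ (translationL2 m (a⁻¹ * x) k) g
  rw [map_mul]
  rw [mul_apply_eq_comp, inner_translationL2 m a⁻¹, inv_inv]

/-- Moves a translation from the operator to the vector `k`, so that strong continuity of
translations becomes norm continuity of `x ↦ S * u x`. -/
theorem coeffL2_translationL2 (k : Lp ℂ 2 m) (a : G) :
    coeffL2 m (translationL2 m a k) = coeffL2 m k * translationL2 m a⁻¹ := by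
  ext1 g
  refine congrArg (ContinuousMap.toLp 2 m ℂ) (ContinuousMap.ext fun x => ?_)
  change inner ℂ (translationL2 m x (translationL2 m a k)) g =
    inner ℂ (translationL2 m x k) (translationL2 m a⁻¹ g)
  rw [← inner_translationL2, ← mul_apply_eq_comp, ← mul_apply_eq_comp,
    ← map_mul, ← map_mul, mul_comm]

theorem continuous_coeffL2 : Continuous (coeffL2 m) := by
  refine (LipschitzWith.of_dist_le_mul
    (K := ‖(ContinuousMap.toLp 2 m ℂ : C(G, ℂ) →L[ℂ] Lp ℂ 2 m)‖₊) fun k k' => ?_).continuous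
  have h : coeffL2 m k - coeffL2 m k' = coeffL2 m (k - k') := by
    ext1 g
    refine (map_sub (ContinuousMap.toLp 2 m ℂ) _ _).symm.trans
      (congrArg (ContinuousMap.toLp 2 m ℂ) (ContinuousMap.ext fun x => ?_))
    change inner ℂ (translationL2 m x k) g - inner ℂ (translationL2 m x k') g =
      inner ℂ (translationL2 m x (k - k')) g
    rw [map_sub, inner_sub_left]
  rw [dist_eq_norm, dist_eq_norm, h, coeffL2, coe_nnnorm]
  refine (ContinuousLinearMap.opNorm_comp_le _ _).trans ?_
  gcongr
  exact LinearMap.mkContinuous_norm_le _ (norm_nonneg _) _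

end Haar

/-- The characters of a compact abelian group separate its points. -/
theorem exists_pontryaginDual_apply_ne_one {G : Type*} [CommGroup G] [TopologicalSpace G]
    [IsTopologicalGroup G] [CompactSpace G] [T2Space G] {x₀ : G} (hx₀ : x₀ ≠ 1) :
    ∃ γ : PontryaginDual G, γ x₀ ≠ 1 := by
  borelize G
  let m : Measure G := Measure.haar
  obtain ⟨f, hf⟩ : ∃ f : C(G, ℂ), f x₀ ≠ f 1 := by
    obtain ⟨f, hf0, hf1, -⟩ := exists_continuous_zero_one_of_isClosed
      (isClosed_singleton (x := x₀)) (isClosed_singleton (x := (1 : G)))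
      (Set.disjoint_singleton.2 hx₀)
    refine ⟨⟨fun x => (f x : ℂ), by fun_prop⟩, ?_⟩
    simp [hf0 (Set.mem_singleton _), hf1 (Set.mem_singleton _)]
  set g : Lp ℂ 2 m := ContinuousMap.toLp 2 m ℂ f
  -- With this `k`, the equation `T * u x₀ = T` for `T = star S * S` would force `T k = 0`, hence `S
  -- k = 0`. But `S k` is represented by a continuous function with value `‖k‖² ≠ 0` at 1.
  set k : Lp ℂ 2 m := translationL2 m x₀ g - g with hk
  have hk0 : k ≠ 0 := by
    intro h
    have h1 : translationL2 m x₀ g =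
        ContinuousMap.toLp 2 m ℂ (f.comp ⟨fun y => x₀ * y, by fun_prop⟩) := by
      apply Lp.ext
      refine (translationL2_ae m x₀ g).trans (.trans ?_ (ContinuousMap.coeFn_toLp m _).symm)
      exact (measurePreserving_mul_left m x₀).quasiMeasurePreserving.ae_eq_comp
        (ContinuousMap.coeFn_toLp m f)
    have h2 := ContinuousMap.toLp_injective m (h1.symm.trans (sub_eq_zero.1 h))
    exact hf (by simpa using DFunLike.congr_fun h2 1)
  set S := coeffL2 m k
  have hSk : S k ≠ 0 := by
    intro h
    have h1 : matrixCoeff (translationL2 m) (norm_translationL2 m) (continuous_translationL2 m) k k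
        = 0 := ContinuousMap.toLp_injective (p := 2) (𝕜 := ℂ) m (h.trans (map_zero _).symm)
    have h2 : inner ℂ (translationL2 m 1 k) k = 0 := DFunLike.congr_fun h1 1
    rw [map_one] at h2
    exact hk0 (inner_self_eq_zero.1 h2)
  have hSu : ∀ a, S * translationL2 m a = translationL2 m a⁻¹ * S := coeffL2_mul_translationL2 m k
  have hSu' : ∀ a, star S * translationL2 m a = translationL2 m a⁻¹ * star S := fun a => by
    have := congrArg star (hSu a)
    rw [star_mul, star_mul, star_translationL2, star_translationL2, inv_inv] at this
    exact this.symm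
  refine exists_pontryaginDual_ne_one_of_cstar (translationL2 m) (star_translationL2 m)
    (star S * S) (.star_mul_self S) (fun x => ?_) ?_ (x₀ := x₀) fun h => hSk ?_
  · rw [mul_assoc, hSu, ← mul_assoc, ← mul_assoc, hSu', inv_inv]
  · have : ∀ x, star S * S * translationL2 m x = star S * coeffL2 m (translationL2 m x⁻¹ k) :=
      fun x => by rw [coeffL2_translationL2, inv_inv, mul_assoc]
    simp only [this]
    exact continuous_const.mul ((continuous_coeffL2 m).comp
      ((continuous_translationL2 m k).comp continuous_inv))
  · have h1 : (star S * S) k = 0 := by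
      rw [hk, map_sub, ← mul_apply_eq_comp, h, sub_self]
    have h2 : inner ℂ (S k) (S k) = 0 := by
      rw [← ContinuousLinearMap.adjoint_inner_left]
      rw [mul_apply_eq_comp, ContinuousLinearMap.star_eq_adjoint] at h1
      rw [h1, inner_zero_left]
    exact inner_self_eq_zero.1 h2

/-- The characters of `G` as continuous complex-valued functions. -/
noncomputable def charMap (G : Type*) [CommGroup G] [TopologicalSpace G] :
    PontryaginDual G →* C(G, ℂ) where
  toFun γ := ⟨fun x => (γ x : ℂ), by fun_prop⟩
  map_one' := rfl
  map_mul' _ _ := rfl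

@[simp]
theorem charMap_apply {G : Type*} [CommGroup G] [TopologicalSpace G] (γ : PontryaginDual G)
    (x : G) : charMap G γ x = γ x :=
  rfl

/-- Trigonometric polynomials are dense in `C(G)`. -/
theorem dense_span_range_charMap {G : Type*} [CommGroup G] [TopologicalSpace G]
    [IsTopologicalGroup G] [CompactSpace G] [T2Space G] :
    Dense (Submodule.span ℂ (Set.range (charMap G)) : Set C(G, ℂ)) := by
  let A : StarSubalgebra ℂ C(G, ℂ) :=
    { toSubalgebra := Algebra.adjoin ℂ (Set.range (charMap G))
      star_mem' := by
        change Algebra.adjoin ℂ (Set.range (charMap G)) ≤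
          star (Algebra.adjoin ℂ (Set.range (charMap G)))
        refine Algebra.adjoin_le ?_
        rintro - ⟨γ, rfl⟩
        refine Algebra.subset_adjoin ⟨γ⁻¹, ContinuousMap.ext fun x => ?_⟩
        exact Circle.coe_inv_eq_conj (γ x) }
  have hA : (A : Set C(G, ℂ)) = Submodule.span ℂ (Set.range (charMap G)) := by
    -- Products of characters are characters, so the linear span is already an algebra.
    have h : Subalgebra.toSubmodule (Algebra.adjoin ℂ (Set.range (charMap G))) =
        Submodule.span ℂ (Set.range (charMap G)) := by
      rw [Algebra.adjoin_eq_span, ← MonoidHom.coe_mrange, Submonoid.closure_eq]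
    exact congrArg SetLike.coe h
  have hsep : A.SeparatesPoints := by
    intro x y hxy
    obtain ⟨γ, hγ⟩ := exists_pontryaginDual_apply_ne_one
      (fun h => hxy (mul_inv_eq_one.1 h) : x * y⁻¹ ≠ 1)
    refine ⟨_, ⟨charMap G γ, Algebra.subset_adjoin ⟨γ, rfl⟩, rfl⟩, fun h => hγ ?_⟩
    rw [map_mul, map_inv, mul_inv_eq_one]
    exact Circle.ext h
  have h := ContinuousMap.starSubalgebra_topologicalClosure_eq_top_of_separatesPoints A hsep
  rw [← hA, dense_iff_closure_eq, ← StarSubalgebra.topologicalClosure_coe, h]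
  rfl

/-! ### Integrals against complex measures -/

section ComplexMeasure

theorem ContinuousMap.integrable_of_compactSpace {X : Type*} [MeasurableSpace X]
    [TopologicalSpace X] [CompactSpace X] [BorelSpace X]
    (ν : Measure X) [IsFiniteMeasure ν] (h : C(X, ℂ)) :
    Integrable h ν :=
  .of_bound h.continuous.measurable.aestronglyMeasurable ‖h‖ (.of_forall h.norm_coe_le_norm)

variable {X : Type*} [MeasurableSpace X] (μ : ComplexMeasure X)

theorem complexMeasure_integral_const_mul (c : ℂ) (f : X → ℂ) :
    VectorMeasure.integral μ (fun x => c * f x) (ContinuousLinearMap.mul ℝ ℂ) =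
      c * VectorMeasure.integral μ f (ContinuousLinearMap.mul ℝ ℂ) :=
  setToFun_smul _ (fun c s x => by
    change (c • x) * μ s = c • (x * μ s)
    simp [mul_assoc]) c f

theorem norm_complexMeasure_integral_le (f : X → ℂ) :
    ‖VectorMeasure.integral μ f (ContinuousLinearMap.mul ℝ ℂ)‖ ≤ ∫ x, ‖f x‖ ∂μ.variation := by
  refine VectorMeasure.norm_integral_le_integral_norm.trans ?_
  exact mul_le_of_le_one_left (integral_nonneg fun x => norm_nonneg _)
    (ContinuousLinearMap.opNorm_mul_le ℝ ℂ)

theorem complexMeasure_integral_indicator_singleton [MeasurableSingletonClass X]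
    [IsFiniteMeasure μ.variation] (b : X) (c : ℂ) :
    VectorMeasure.integral μ (({b} : Set X).indicator fun _ => c) (ContinuousLinearMap.mul ℝ ℂ) =
      c * μ {b} :=
  setToFun_indicator_const _ (measurableSet_singleton b) (measure_ne_top _ _) c

theorem exists_singleton_ne_zero_of_countable [MeasurableSingletonClass X] {B : Set X}
    (hB : B.Countable) (h : μ B ≠ 0) : ∃ b, μ {b} ≠ 0 := by
  by_contra! h0
  apply h
  have := hB.to_subtype
  rw [← Set.iUnion_of_singleton_coe B, VectorMeasure.of_disjoint_iUnion
    (fun b => measurableSet_singleton _)]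
  · simp [h0]
  · intro a b hab
    simpa [Function.onFun] using fun h => hab (Subtype.ext h)

variable [TopologicalSpace X] [CompactSpace X] [BorelSpace X] [IsFiniteMeasure μ.variation]

/-- Integration against a complex measure as a functional on the continuous functions. -/
noncomputable def complexMeasureCLM : C(X, ℂ) →L[ℂ] ℂ :=
  LinearMap.mkContinuous
    { toFun := fun h => VectorMeasure.integral μ h (ContinuousLinearMap.mul ℝ ℂ)
      map_add' := fun h h' => VectorMeasure.integral_add
        (h.integrable_of_compactSpace _) (h'.integrable_of_compactSpace _)
      map_smul' := fun c h => complexMeasure_integral_const_mul μ c h }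
    (μ.variation.real Set.univ) fun h => by
      refine (norm_complexMeasure_integral_le μ h).trans ?_
      refine (integral_mono (h.integrable_of_compactSpace _).norm (integrable_const ‖h‖)
        h.norm_coe_le_norm).trans ?_
      simp

theorem norm_complexMeasureCLM_le : ‖complexMeasureCLM μ‖ ≤ μ.variation.real Set.univ :=
  LinearMap.mkContinuous_norm_le _ measureReal_nonneg _

end ComplexMeasure

/-! ### Pairing of integrable functions with continuous functions -/

section Pairing

variable {X : Type*} [MeasurableSpace X] [TopologicalSpace X] [CompactSpace X] [BorelSpace X]
  (m : Measure X)

variable {m} in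
theorem integrable_continuousMap_mul (f : Lp ℂ 1 m) (h : C(X, ℂ)) :
    Integrable (fun x => h x * f x) m :=
  (L1.integrable_coeFn f).bdd_mul h.continuous.measurable.aestronglyMeasurable
    (.of_forall h.norm_coe_le_norm)

/-- The pairing `(f, h) ↦ ∫ h * f dm` of `L¹` with the continuous functions. -/
noncomputable def pairL1 : Lp ℂ 1 m →L[ℂ] C(X, ℂ) →L[ℂ] ℂ :=
  LinearMap.mkContinuous₂
    (LinearMap.mk₂ ℂ (fun (f : Lp ℂ 1 m) (h : C(X, ℂ)) => ∫ x, h x * f x ∂m)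
      (fun f f' h => by
        rw [← integral_add (integrable_continuousMap_mul f h) (integrable_continuousMap_mul f' h)]
        refine integral_congr_ae ?_
        filter_upwards [Lp.coeFn_add f f'] with x hx
        rw [hx, Pi.add_apply, mul_add])
      (fun c f h => by
        rw [smul_eq_mul, ← integral_const_mul]
        refine integral_congr_ae ?_
        filter_upwards [Lp.coeFn_smul c f] with x hx
        rw [hx, Pi.smul_apply, smul_eq_mul, mul_left_comm])
      (fun f h h' => by
        rw [← integral_add (integrable_continuousMap_mul f h) (integrable_continuousMap_mul f h')]
        exact integral_congr_ae (.of_forall fun x => add_mul _ _ _))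
      (fun c f h => by
        rw [smul_eq_mul, ← integral_const_mul]
        exact integral_congr_ae (.of_forall fun x => mul_assoc _ _ _)))
    1 fun f h => by
      change ‖∫ x, h x * f x ∂m‖ ≤ _
      rw [one_mul, L1.norm_eq_integral_norm, mul_comm, ← integral_const_mul]
      refine norm_integral_le_of_norm_le ((L1.integrable_coeFn f).norm.const_mul _)
        (.of_forall fun x => ?_)
      rw [norm_mul]
      gcongr
      exact h.norm_coe_le_norm x

theorem pairL1_apply (f : Lp ℂ 1 m) (h : C(X, ℂ)) : pairL1 m f h = ∫ x, h x * f x ∂m :=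
  rfl

theorem norm_pairL1_le (f : Lp ℂ 1 m) (h : C(X, ℂ)) : ‖pairL1 m f h‖ ≤ ‖f‖ * ‖h‖ := by
  refine ((pairL1 m).le_opNorm₂ f h).trans ?_
  gcongr
  exact mul_le_of_le_one_left (norm_nonneg _) (LinearMap.mkContinuous₂_norm_le _ zero_le_one _)

/-- Intended for `f` concentrated on `K`: a crude bound `b` for `h` off `K` then costs little. -/
theorem norm_pairL1_le_of_le (f : Lp ℂ 1 m) (h : C(X, ℂ)) {K : Set X} (hK : MeasurableSet K)
    {a b : ℝ} (ha : ∀ x ∈ K, ‖h x‖ ≤ a) (hb : ∀ x, ‖h x‖ ≤ b) (ha0 : 0 ≤ a) :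
    ‖pairL1 m f h‖ ≤ a * ‖f‖ + b * ∫ x in Kᶜ, ‖f x‖ ∂m := by
  have hf := (L1.integrable_coeFn f).norm
  rw [pairL1_apply, L1.norm_eq_integral_norm, ← integral_indicator hK.compl, ← integral_const_mul,
    ← integral_const_mul, ← integral_add (hf.const_mul _) ((hf.indicator hK.compl).const_mul _)]
  refine norm_integral_le_of_norm_le ((hf.const_mul _).add ((hf.indicator hK.compl).const_mul _))
    (.of_forall fun x => ?_)
  rw [norm_mul]
  by_cases hx : x ∈ K
  · simpa [hx] using mul_le_mul_of_nonneg_right (ha x hx) (norm_nonneg _)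
  · simp only [Set.mem_compl_iff, hx, not_false_eq_true, Set.indicator_of_mem]
    nlinarith [mul_le_mul_of_nonneg_right (hb x) (norm_nonneg (f x)),
      mul_nonneg ha0 (norm_nonneg (f x))]

theorem exists_norm_sub_le_norm_pairL1 [T2Space X] [m.Regular] [IsProbabilityMeasure m]
    (f : Lp ℂ 1 m) {ε : ℝ} (hε : 0 < ε) :
    ∃ h : C(X, ℂ), ‖h‖ ≤ 1 ∧ ‖f‖ - ε ≤ ‖pairL1 m f h‖ := by
  obtain ⟨g, hg⟩ : ∃ g : C(X, ℂ), ‖f - ContinuousMap.toLp 1 m ℂ g‖ < ε / 3 := by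
    obtain ⟨g, hg⟩ := (ContinuousMap.toLp_denseRange (p := 1) (E := ℂ) m ℂ
      ENNReal.one_ne_top).exists_dist_lt f (show 0 < ε / 3 by positivity)
    exact ⟨g, by rwa [← dist_eq_norm]⟩
  -- `δ` is lost three times: twice in replacing `f` by `g`, once in regularizing the phase `conj g
  -- / ‖g‖` to a continuous function. The last loss comes from `t² / (t + δ) ≥ t - δ`.
  set δ := ε / 3 with hδ
  have hδ0 : 0 < δ := by positivity
  have hpos : ∀ x, 0 < ‖g x‖ + δ := fun x => by positivity
  have hne : ∀ x, ((‖g x‖ + δ : ℝ) : ℂ) ≠ 0 := fun x => Complex.ofReal_ne_zero.2 (hpos x).ne'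
  let h : C(X, ℂ) := ⟨fun x => conj (g x) / ((‖g x‖ + δ : ℝ) : ℂ), by
    refine Continuous.div (by fun_prop) (by fun_prop) hne⟩
  have hh : ‖h‖ ≤ 1 := (ContinuousMap.norm_le _ zero_le_one).2 fun x => by
    change ‖conj (g x) / ((‖g x‖ + δ : ℝ) : ℂ)‖ ≤ 1
    rw [norm_div, RCLike.norm_conj, Complex.norm_real, Real.norm_of_nonneg (hpos x).le,
      div_le_one (hpos x)]
    linarith
  have hgn : ‖ContinuousMap.toLp 1 m ℂ g‖ - δ ≤ ‖pairL1 m (ContinuousMap.toLp 1 m ℂ g) h‖ := by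
    have e1 : pairL1 m (ContinuousMap.toLp 1 m ℂ g) h =
        ((∫ x, ‖g x‖ ^ 2 / (‖g x‖ + δ) ∂m : ℝ) : ℂ) := by
      rw [pairL1_apply, ← integral_complex_ofReal]
      refine integral_congr_ae ?_
      filter_upwards [ContinuousMap.coeFn_toLp (p := 1) (𝕜 := ℂ) m g] with x hx
      rw [hx]
      change conj (g x) / ((‖g x‖ + δ : ℝ) : ℂ) * g x = _
      rw [div_mul_eq_mul_div, Complex.conj_mul']
      push_cast
      rfl
    have e2 : ‖ContinuousMap.toLp 1 m ℂ g‖ = ∫ x, ‖g x‖ ∂m := by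
      rw [L1.norm_eq_integral_norm]
      refine integral_congr_ae ?_
      filter_upwards [ContinuousMap.coeFn_toLp (p := 1) (𝕜 := ℂ) m g] with x hx
      rw [hx]
    have hi : Integrable (fun x => ‖g x‖) m := (g.integrable_of_compactSpace m).norm
    have e3 : (∫ x, ‖g x‖ ∂m) - δ = ∫ x, (‖g x‖ - δ) ∂m := by
      rw [integral_sub hi (integrable_const δ)]
      simp
    rw [e1, e2, e3, Complex.norm_real]
    refine le_trans ?_ (Real.le_norm_self _)
    refine integral_mono (hi.sub (integrable_const δ)) ?_ fun x => ?_
    · refine hi.mono' ?_ (.of_forall fun x => ?_)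
      · have : Continuous fun x => ‖g x‖ ^ 2 / (‖g x‖ + δ) :=
          Continuous.div (by fun_prop) (by fun_prop) fun x => (hpos x).ne'
        exact this.measurable.aestronglyMeasurable
      · rw [Real.norm_of_nonneg (by positivity), div_le_iff₀ (hpos x)]
        nlinarith [norm_nonneg (g x)]
    · change ‖g x‖ - δ ≤ ‖g x‖ ^ 2 / (‖g x‖ + δ)
      rw [le_div_iff₀ (hpos x)]
      nlinarith
  refine ⟨h, hh, ?_⟩
  have e4 : pairL1 m f h = pairL1 m (ContinuousMap.toLp 1 m ℂ g) h +
      pairL1 m (f - ContinuousMap.toLp 1 m ℂ g) h := by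
    rw [map_sub, sub_apply, add_sub_cancel]
  have e5 := norm_pairL1_le m (f - ContinuousMap.toLp 1 m ℂ g) h
  have e6 := norm_sub_le_norm_add (pairL1 m (ContinuousMap.toLp 1 m ℂ g) h)
    (pairL1 m (f - ContinuousMap.toLp 1 m ℂ g) h)
  have e7 := norm_sub_norm_le f (ContinuousMap.toLp 1 m ℂ g)
  have e8 := mul_le_of_le_one_right (norm_nonneg (f - ContinuousMap.toLp 1 m ℂ g)) hh
  rw [e4]
  linarith

end Pairing

/-! ### Convolution of continuous functions with complex measures -/

section Convolution

variable {G : Type*} [CommGroup G] [TopologicalSpace G] [IsTopologicalGroup G] [CompactSpace G]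
  [MeasurableSpace G] [BorelSpace G] (μ : ComplexMeasure G) [IsFiniteMeasure μ.variation]

/-- The family of functions `y ↦ h (x * y⁻¹)`, depending continuously on `x`. -/
noncomputable def divFamily (h : C(G, ℂ)) : C(G, C(G, ℂ)) :=
  ContinuousMap.curry ⟨fun p : G × G => h (p.1 * p.2⁻¹), by fun_prop⟩

/-- The convolution `x ↦ ∫ h (x * y⁻¹) dμ(y)` as an operator on the continuous functions. -/
noncomputable def convMeasure : C(G, ℂ) →L[ℂ] C(G, ℂ) :=
  LinearMap.mkContinuous
    { toFun := fun h => (ContinuousMap.mk _ (complexMeasureCLM μ).continuous).comp (divFamily h)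
      map_add' := fun h h' => ContinuousMap.ext fun x =>
        map_add (complexMeasureCLM μ) (divFamily h x) (divFamily h' x)
      map_smul' := fun c h => ContinuousMap.ext fun x =>
        map_smul (complexMeasureCLM μ) c (divFamily h x) }
    (μ.variation.real Set.univ) fun h => by
      refine (ContinuousMap.norm_le _ (by positivity)).2 fun x => ?_
      change ‖complexMeasureCLM μ (divFamily h x)‖ ≤ _
      refine (complexMeasureCLM μ).le_of_opNorm_le_of_le (norm_complexMeasureCLM_le μ) ?_
      exact (ContinuousMap.norm_le _ (norm_nonneg _)).2 fun y => h.norm_coe_le_norm _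

theorem convMeasure_apply (h : C(G, ℂ)) (x : G) : convMeasure μ h x =
    VectorMeasure.integral μ (fun y => h (x * y⁻¹)) (ContinuousLinearMap.mul ℝ ℂ) :=
  rfl

theorem norm_convMeasure_le (h : C(G, ℂ)) :
    ‖convMeasure μ h‖ ≤ μ.variation.real Set.univ * ‖h‖ :=
  (convMeasure μ).le_of_opNorm_le (LinearMap.mkContinuous_norm_le _ measureReal_nonneg _) h

theorem convMeasure_charMap (γ : PontryaginDual G) :
    convMeasure μ (charMap G γ) = fourierStieltjes μ γ • charMap G γ := by
  ext x
  rw [convMeasure_apply, ContinuousMap.smul_apply, smul_eq_mul, mul_comm, fourierStieltjes,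
    ← complexMeasure_integral_const_mul]
  congr 1
  ext y
  rw [charMap_apply, charMap_apply, map_mul, map_inv, Circle.coe_mul, Circle.coe_inv_eq_conj]

theorem pairL1_convMeasure_eq_zero [T2Space G] (m : Measure G) {Λ : Set (PontryaginDual G)}
    (hμ : specMeasure μ ⊆ Λ) {f : Lp ℂ 1 m} (hf : specL1 f ⊆ (Λ⁻¹)ᶜ) (h : C(G, ℂ)) :
    pairL1 m f (convMeasure μ h) = 0 := by
  suffices H : (pairL1 m f).comp (convMeasure μ) = 0 from DFunLike.congr_fun H h
  refine ContinuousLinearMap.ext_on dense_span_range_charMap ?_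
  rintro - ⟨γ, rfl⟩
  rw [ContinuousLinearMap.comp_apply, convMeasure_charMap, map_smul, smul_eq_mul, zero_apply]
  by_cases hγ : γ ∈ specMeasure μ
  · have h1 : γ⁻¹ ∉ specL1 f := fun h1 => hf h1 (Set.inv_mem_inv.2 (hμ hγ))
    have h2 : fourierL1 f γ⁻¹ = 0 := not_not.1 h1
    have h3 : pairL1 m f (charMap G γ) = fourierL1 f γ⁻¹ := by
      refine integral_congr_ae (.of_forall fun x => ?_)
      change (γ x : ℂ) * f x = conj (((γ x)⁻¹ : Circle) : ℂ) * f x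
      rw [Circle.coe_inv_eq_conj, Complex.conj_conj]
    rw [h3, h2, mul_zero]
  · rw [show fourierStieltjes μ γ = 0 from not_not.1 hγ, zero_mul]

/-- Near the identity, convolving with a measure with an atom at `b` a function that lives near
`b⁻¹` amounts to translating it and multiplying it by the mass of the atom. -/
theorem norm_convMeasure_sub_le [T2Space G] (b : G) {κ : C(G, ℂ)} {V : Set G}
    (hκ : ‖κ‖ ≤ 1) (hV : ∀ x ∉ V, κ x = 0) {W : Set G} (hW : IsOpen W)
    (hVW : ∀ x ∈ V, ∀ y ∈ V, b * x * y⁻¹ ∈ W) {x : G} (hx : x ∈ V) :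
    ‖convMeasure μ (κ.comp ⟨fun y => y * b, by fun_prop⟩) x - μ {b} * κ x‖ ≤
      μ.variation.real (W \ {b}) := by
  have hc : Continuous fun y => κ (x * y⁻¹ * b) := by fun_prop
  have hi : Integrable (fun y => κ (x * y⁻¹ * b)) μ.variation :=
    ContinuousMap.integrable_of_compactSpace μ.variation ⟨_, hc⟩
  have hWb : MeasurableSet (W \ {b}) := hW.measurableSet.diff (measurableSet_singleton b)
  have hs : Integrable (({b} : Set G).indicator fun _ => κ x) μ.variation :=
    (integrable_const _).indicator (measurableSet_singleton b)
  have h1 : convMeasure μ (κ.comp ⟨fun y => y * b, by fun_prop⟩) x - μ {b} * κ x =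
      VectorMeasure.integral μ
        (fun y => κ (x * y⁻¹ * b) - ({b} : Set G).indicator (fun _ => κ x) y)
        (ContinuousLinearMap.mul ℝ ℂ) := by
    rw [VectorMeasure.integral_fun_sub hi hs, mul_comm,
      ← complexMeasure_integral_indicator_singleton μ b (κ x)]
    rfl
  rw [h1]
  refine (norm_complexMeasure_integral_le μ _).trans ?_
  rw [← integral_indicator_one hWb]
  refine integral_mono (hi.sub hs).norm ((integrable_const 1).indicator hWb) fun y => ?_
  by_cases hy : y = b
  · subst hy
    simp
  · have hy' : y ∉ ({b} : Set G) := hy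
    simp only [Set.indicator_of_notMem hy', sub_zero]
    by_cases hyW : y ∈ W
    · rw [Set.indicator_of_mem (Set.mem_sdiff_of_mem hyW hy')]
      exact (κ.norm_coe_le_norm _).trans hκ
    -- If `v = x * y⁻¹ * b` lay in `V`, then `y = b * x * v⁻¹` would lie in `W`.
    · have : κ (x * y⁻¹ * b) = 0 := hV _ fun hv => hyW (by
        have hmem := hVW x hx _ hv
        rwa [mul_right_comm x, mul_comm x b, mul_inv, inv_inv, mul_inv_cancel_left] at hmem)
      rw [this, norm_zero]
      exact Set.indicator_nonneg (fun _ _ => zero_le_one) _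

end Convolution

/-! ### Rich subspaces and atoms -/

/-- Integration over a measurable set as a functional on `L¹`. -/
noncomputable def setIntegralL1 {X : Type*} [MeasurableSpace X] (m : Measure X) (K : Set X) :
    Lp ℂ 1 m →L[ℂ] ℂ :=
  LinearMap.mkContinuous
    { toFun := fun f => ∫ x in K, f x ∂m
      map_add' := fun f g => by
        rw [← integral_add (L1.integrable_coeFn f).integrableOn (L1.integrable_coeFn g).integrableOn]
        exact integral_congr_ae (ae_restrict_of_ae (Lp.coeFn_add f g))
      map_smul' := fun c f => by
        rw [RingHom.id_apply, smul_eq_mul, ← integral_const_mul]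
        exact integral_congr_ae (ae_restrict_of_ae (Lp.coeFn_smul c f)) } 1 fun f => by
    rw [one_mul, L1.norm_eq_integral_norm]
    exact (norm_integral_le_integral_norm _).trans
      (setIntegral_le_integral (L1.integrable_coeFn f).norm (.of_forall fun x => norm_nonneg _))

/-- If the quotient map by `Y` is narrow, there are functions of norm almost `2`, close to `Y`,
that are concentrated on a given set of positive measure. -/
theorem IsRich.exists_concentrated {X : Type*} [MeasurableSpace X] {m : Measure X}
    [IsProbabilityMeasure m] {Y : ClosedSubmodule ℂ (Lp ℂ 1 m)} (hY : IsRich Y) {K : Set X}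
    (hK : MeasurableSet K) (hmK : m K ≠ 0) {ε : ℝ} (hε : 0 < ε) :
    ∃ w : Lp ℂ 1 m, ‖w‖ ≤ 2 ∧ 2 - ε ≤ ‖w‖ ∧ ∫ x in Kᶜ, ‖w x‖ ∂m ≤ ε ∧
      ∃ v : Lp ℂ 1 m, w - v ∈ Y.toSubmodule ∧ ‖v‖ ≤ 2 * ε := by
  have hmK' : m.real K ≠ 0 := (measureReal_ne_zero_iff (measure_ne_top m K)).2 hmK
  set y : Lp ℂ 1 m := indicatorConstLp 1 hK (measure_ne_top m K) ((m.real K : ℂ)⁻¹) with hy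
  have hynorm : ‖y‖ = 1 := by
    rw [hy, norm_indicatorConstLp one_ne_zero ENNReal.one_ne_top]
    rw [norm_inv, Complex.norm_real, Real.norm_of_nonneg measureReal_nonneg]
    simp [hmK']
  have hyae : y =ᵐ[m] K.indicator fun _ => (m.real K : ℂ)⁻¹ := indicatorConstLp_coeFn
  have hyint : setIntegralL1 m K y = 1 := by
    change ∫ x in K, y x ∂m = 1
    rw [integral_congr_ae (ae_restrict_of_ae hyae), integral_indicator hK, Measure.restrict_restrict hK,
      Set.inter_self]
    simp [hmK']
  -- Taking `x = -y` makes `‖y - z‖` almost 2. The functional keeps `∫_K z` near 1, and as `‖z‖ = 1`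
  -- this leaves `z` mass at most `ε` off `K`, where `y` vanishes.
  obtain ⟨z, hz, hzy, hzn⟩ := hY (-y) y (by rwa [norm_neg]) hynorm (setIntegralL1 m K) ε hε
  have hcl : IsClosed (Y.toSubmodule : Set (Lp ℂ 1 m)) := Y.isClosed
  obtain ⟨v, hv, hvn⟩ := Submodule.Quotient.norm_mk_lt (S := Y.toSubmodule)
    (Y.toSubmodule.mkQ (y - z)) hε
  have h1 : ‖Y.toSubmodule.mkQ (y - z)‖ ≤ ε :=
    (le_add_of_nonneg_right (norm_nonneg _)).trans hzy
  have h2 : ‖1 - ∫ x in K, z x ∂m‖ ≤ ε := by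
    have : setIntegralL1 m K (y - z) = 1 - ∫ x in K, z x ∂m := by
      rw [map_sub, hyint]
      rfl
    rw [← this]
    exact (le_add_of_nonneg_left (norm_nonneg _)).trans hzy
  refine ⟨y - z, ?_, ?_, ?_, v, ?_, ?_⟩
  · exact (norm_sub_le _ _).trans (by rw [hynorm, hz]; norm_num)
  · rwa [neg_add_eq_sub, norm_sub_rev] at hzn
  · have h3 : ∫ x in Kᶜ, ‖(y - z : Lp ℂ 1 m) x‖ ∂m = ∫ x in Kᶜ, ‖z x‖ ∂m := by
      refine setIntegral_congr_ae hK.compl ?_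
      filter_upwards [Lp.coeFn_sub y z, hyae] with x hx hx' hxK
      rw [hx, Pi.sub_apply, hx', Set.indicator_of_notMem hxK, zero_sub, norm_neg]
    have h4 := integral_add_compl hK (L1.integrable_coeFn z).norm
    rw [← L1.norm_eq_integral_norm, hz] at h4
    have h5 : ‖∫ x in K, z x ∂m‖ ≤ ∫ x in K, ‖z x‖ ∂m := norm_integral_le_integral_norm _
    have h6 := norm_sub_norm_le (1 : ℂ) (∫ x in K, z x ∂m)
    rw [norm_one] at h6
    linarith
  · exact (Submodule.Quotient.eq _).1 hv.symm
  · linarith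

section Atoms

variable {G : Type*} [CommGroup G] [TopologicalSpace G] [IsTopologicalGroup G] [CompactSpace G]
  [T2Space G] [MeasurableSpace G] [BorelSpace G] (m : Measure G) [m.IsHaarMeasure] [m.Regular]
  [IsProbabilityMeasure m]

/-- Regularity: a point `b` has an open neighbourhood that contains some `b * V / V` and carries
little mass apart from `b`. -/
theorem exists_nhds_one_variation_lt (ν : Measure G) [ν.Regular] (b : G) {η : ℝ} (hη : 0 < η) :
    ∃ W : Set G, IsOpen W ∧ ν.real (W \ {b}) ≤ η ∧ ∃ V : Set G, IsOpen V ∧ (1 : G) ∈ V ∧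
      ∀ x ∈ V, ∀ y ∈ V, b * x * y⁻¹ ∈ W := by
  obtain ⟨W, hbW, hW, hνW⟩ := Set.exists_isOpen_lt_add {b} (measure_ne_top ν {b})
    (ENNReal.ofReal_pos.2 hη).ne'
  have hc : Continuous fun p : G × G => b * p.1 * p.2⁻¹ := by fun_prop
  have hmem : (fun p : G × G => b * p.1 * p.2⁻¹) ⁻¹' W ∈ nhds ((1 : G), (1 : G)) :=
    (hW.preimage hc).mem_nhds (by simpa using hbW)
  rw [nhds_prod_eq, Filter.mem_prod_same_iff] at hmem
  obtain ⟨U, hU, hUW⟩ := hmem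
  obtain ⟨V, hVU, hV, h1V⟩ := mem_nhds_iff.1 hU
  refine ⟨W, hW, ?_, V, hV, h1V, fun x hx y hy => hUW (Set.mk_mem_prod (hVU hx) (hVU hy))⟩
  have h : ν (W \ {b}) ≤ ENNReal.ofReal η := by
    rw [measure_sdiff hbW (measurableSet_singleton b).nullMeasurableSet (measure_ne_top ν {b})]
    exact tsub_le_iff_left.2 hνW.le
  exact ENNReal.toReal_le_of_le_ofReal hη.le h

theorem IsRich.singleton_eq_zero {Λ : Set (PontryaginDual G)} (h : IsRich (L1Spec m (Λ⁻¹)ᶜ))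
    {μ : ComplexMeasure G} (hμr : μ.variation.Regular) (hμ : specMeasure μ ⊆ Λ) (b : G) :
    μ {b} = 0 := by
  by_contra hb
  have hc0 : 0 < ‖μ {b}‖ := norm_pos_iff.2 hb
  set c := ‖μ {b}‖
  set M := μ.variation.real Set.univ
  have hcM : c ≤ M := (VectorMeasure.norm_measure_le_variation (measure_ne_top _ _)).trans
    (measureReal_mono (Set.subset_univ _))
  obtain ⟨W, hW, hWη, V, hV, h1V, hVW⟩ :=
    exists_nhds_one_variation_lt μ.variation b (show 0 < c / 4 by positivity)
  obtain ⟨K, hK1, hKc, hKV⟩ := exists_mem_nhds_isClosed_subset (hV.mem_nhds h1V)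
  have hmK : m K ≠ 0 := (Measure.measure_pos_of_mem_nhds m hK1).ne'
  obtain ⟨k, hk0, hk1, hk01⟩ := exists_continuous_zero_one_of_isClosed hV.isClosed_compl hKc
    (Set.disjoint_left.2 fun x hx hxK => hx (hKV hxK))
  -- Chosen so that all errors `M * ε` and `c * ε` are at most `c / 16`.
  set ε := c / (16 * M) with hε
  have hM0 : 0 < M := hc0.trans_le hcM
  have hε0 : 0 < ε := by positivity
  have hMε : M * ε = c / 16 := by rw [hε]; field_simp
  have hcε : c * ε ≤ c / 16 := hMε ▸ mul_le_mul_of_nonneg_right hcM hε0.le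
  obtain ⟨w, hw2, hwn, hwK, v, hwv, hv⟩ := h.exists_concentrated hKc.measurableSet hmK hε0
  obtain ⟨g, hg1, hg⟩ := exists_norm_sub_le_norm_pairL1 m w hε0
  let κ : C(G, ℂ) := ⟨fun x => (k x : ℂ) * g x, by fun_prop⟩
  have hκg : ∀ x, ‖κ x‖ ≤ 1 := fun x => by
    change ‖(k x : ℂ) * g x‖ ≤ 1
    rw [norm_mul, Complex.norm_real, Real.norm_of_nonneg (hk01 x).1]
    exact mul_le_one₀ (hk01 x).2 (norm_nonneg _) ((g.norm_coe_le_norm x).trans hg1)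
  have hκ : ‖κ‖ ≤ 1 := (ContinuousMap.norm_le _ zero_le_one).2 hκg
  have hκV : ∀ x ∉ V, κ x = 0 := fun x hx => by
    change (k x : ℂ) * g x = 0
    rw [hk0 hx]
    simp
  set P := convMeasure μ (κ.comp ⟨fun y => y * b, by fun_prop⟩) with hP
  have hPn : ‖P‖ ≤ M := by
    refine (norm_convMeasure_le μ _).trans (mul_le_of_le_one_right hM0.le ?_)
    exact (ContinuousMap.norm_le _ zero_le_one).2 fun x => hκg _
  have hwP : ‖pairL1 m w P‖ ≤ c / 8 := by
    have h1 : pairL1 m w P = pairL1 m v P := by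
      rw [← sub_eq_zero, ← sub_apply, ← map_sub]
      exact pairL1_convMeasure_eq_zero μ m hμ hwv _
    rw [h1]
    refine (norm_pairL1_le m v P).trans ?_
    calc ‖v‖ * ‖P‖ ≤ 2 * ε * M := by gcongr
      _ = c / 8 := by linarith
  -- On `K` the atom dominates up to `c / 4`; off `K` the trivial bound `M + c ≤ 2 * M` meets mass
  -- at most `ε` of `w`.
  have hR : ‖pairL1 m w (P - μ {b} • κ)‖ ≤ c / 4 * ‖w‖ + 2 * M * ε := by
    refine (norm_pairL1_le_of_le m w _ hKc.measurableSet (a := c / 4) (b := 2 * M)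
      (fun x hx => ?_) (fun x => ?_) (by positivity)).trans (by gcongr)
    · exact (norm_convMeasure_sub_le μ b hκ hκV hW hVW (hKV hx)).trans hWη
    · change ‖P x - μ {b} * κ x‖ ≤ _
      refine (norm_sub_le _ _).trans ?_
      rw [norm_mul]
      nlinarith [(P.norm_coe_le_norm x).trans hPn, hκg x, norm_nonneg (κ x)]
  have hgκ : ‖pairL1 m w (g - κ)‖ ≤ 0 * ‖w‖ + 1 * ε := by
    refine (norm_pairL1_le_of_le m w _ hKc.measurableSet (a := 0) (b := 1)
      (fun x hx => ?_) (fun x => ?_) le_rfl).trans (by gcongr)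
    · change ‖g x - (k x : ℂ) * g x‖ ≤ 0
      rw [hk1 hx]
      simp
    · change ‖g x - (k x : ℂ) * g x‖ ≤ 1
      have : g x - (k x : ℂ) * g x = ((1 - k x : ℝ) : ℂ) * g x := by push_cast; ring
      rw [this, norm_mul, Complex.norm_real, Real.norm_of_nonneg (sub_nonneg.2 (hk01 x).2)]
      exact mul_le_one₀ (by linarith [(hk01 x).1]) (norm_nonneg _)
        ((g.norm_coe_le_norm x).trans hg1)
  have hκw : 2 - 3 * ε ≤ ‖pairL1 m w κ‖ := by
    rw [map_sub] at hgκ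
    linarith [norm_sub_norm_le (pairL1 m w g) (pairL1 m w κ)]
  rw [map_sub, map_smul, smul_eq_mul] at hR
  have h1 := norm_sub_norm_le (μ {b} * pairL1 m w κ) (pairL1 m w P)
  rw [norm_sub_rev, norm_mul] at h1
  -- The lower bound `c * (2 - 3 * ε) ≥ 29 * c / 16` contradicts the upper bound `c / 8 + c / 2 + c
  -- / 8 = 3 * c / 4`.
  nlinarith [mul_le_mul_of_nonneg_left hκw hc0.le, mul_le_mul_of_nonneg_left hw2 hc0.le]

end Atoms

theorem mainTheorem3 {G : Type*} [CommGroup G] [TopologicalSpace G] [IsTopologicalGroup G]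
    [CompactSpace G] [T2Space G] [Infinite G] [MeasurableSpace G] [BorelSpace G]
    (m : Measure G) [m.IsHaarMeasure] [m.Regular] [IsProbabilityMeasure m]
    (Λ : Set (PontryaginDual G)) (h : IsRich (L1Spec m (Λ⁻¹)ᶜ)) :
    IsSemiRiesz Λ := by
  rintro μ ⟨hμr, hμ⟩ B hB
  by_contra hne
  obtain ⟨b, hb⟩ := exists_singleton_ne_zero_of_countable μ hB hne
  exact hb (h.singleton_eq_zero m hμr hμ b)
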